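/- Let $\Lambda$ and $\Gamma$ be artin algebras (rings that are finitely generated as modules over a commutative artinian ring acting centrally), and let ${}_\Lambda U_\Gamma$ be a bimodule, finitely generated on each side, which is - faithfully balanced: the natural maps $\Lambda\to\operatorname{End}(U_\Gamma)$ and $\Gamma\to\operatorname{End}({}_\Lambda U)^{op}$ are isomorphisms; and - selforthogonal: $\operatorname{Ext}^i_\Lambda(U,U)=0$ and $\operatorname{Ext}^i_\Gamma(U,U)=0$ for all $i\ge 1$. Let $0\to {}_\Lambda U\to E_0\to E_1\to\cdots$ be a minimal injective resolution of ${}_\Lambda U$, and suppose that the injective dimension of ${}_\Lambda U$ equals $k$ for some non-negative integer $k$. Let $\operatorname{add}{}_\Lambda U$ denote the class of all modules isomorphic to direct summands of finite direct sums of copies of ${}_\Lambda U$. (1) $E_k\in\operatorname{add}{}_\Lambda U$ if and only if the left $\Gamma$-module $\operatorname{Hom}_\Lambda(U,E_k)$ is flat. (2) If $E_k\in\operatorname{add}{}_\Lambda U$ (equivalently, if $\operatorname{Hom}_\Lambda(U,E_k)$ is flat over $\Gamma$), then ${}_\Lambda U$ is injective. (3) In particular (the case $U=\Lambda=\Gamma$):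 if $\Lambda$ is an artin algebra whose injective dimension as a left module over itself equals a non-negative integer $k$, and the term $E_k$ of a minimal injective resolution of ${}_\Lambda\Lambda$ is a flat left $\Lambda$-module, then $\Lambda$ is self-injective, that is, ${}_\Lambda\Lambda$ is an injective module. -/

import Mathlib

open CategoryTheory MulOpposite
open scoped TensorProduct

universe u v w

/-! Right `Γ`-modules are modules over `Γᵐᵒᵖ`; a bimodule `_Λ U _Γ` is a type with commuting
module structures over `Λ` and `Γᵐᵒᵖ`. -/

section Bimodule

variable (L : Type u) (G : Type u) (U : Type u) [Ring L] [Ring G] [AddCommGroup U]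
  [Module L U] [Module Gᵐᵒᵖ U] [SMulCommClass L Gᵐᵒᵖ U] [SMulCommClass Gᵐᵒᵖ L U]

/-- The natural maps `L → End(U_G)` and `G → End(_L U)ᵒᵖ` (written here as `Gᵐᵒᵖ → End(_L U)`)
are isomorphisms. -/
def IsFaithfullyBalanced : Prop :=
  Function.Bijective (Module.toModuleEnd Gᵐᵒᵖ U : L →+* Module.End Gᵐᵒᵖ U) ∧
    Function.Bijective (Module.toModuleEnd L U : Gᵐᵒᵖ →+* Module.End L U)

/-- `Ext_L^i(U, U) = 0` and `Ext_G^i(U, U) = 0` for all `i ≥ 1`. -/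
def IsSelforthogonal : Prop :=
  ∀ i : ℕ, 1 ≤ i →
    Subsingleton (Abelian.Ext (ModuleCat.of L U) (ModuleCat.of L U) i) ∧
      Subsingleton (Abelian.Ext (ModuleCat.of Gᵐᵒᵖ U) (ModuleCat.of Gᵐᵒᵖ U) i)

end Bimodule

/-- `M` is isomorphic to a direct summand of a finite direct sum of copies of `U`. -/
def IsInAdd (L : Type u) [Ring L] (U : Type v) [AddCommGroup U] [Module L U]
    (M : Type w) [AddCommGroup M] [Module L M] : Prop :=
  ∃ (n : ℕ) (P Q : Submodule L (Fin n → U)), IsCompl P Q ∧ Nonempty (M ≃ₗ[L] P)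

section HomModule

/-- The abelian group `Hom_L(U, E)`, as a type synonym that carries the left `G`-module structure
induced by the right action of `G` on `U`. -/
def HomFrom (L : Type u) [Ring L] (U : Type v) [AddCommGroup U] [Module L U]
    (E : Type w) [AddCommGroup E] [Module L E] : Type (max v w) :=
  U →ₗ[L] E

variable (L : Type u) [Ring L] (U : Type v) [AddCommGroup U] [Module L U]
    (E : Type w) [AddCommGroup E] [Module L E]

instance : AddCommGroup (HomFrom L U E) :=
  inferInstanceAs (AddCommGroup (U →ₗ[L] E))

/-- `(g • f) u = f (u g)`. -/
instance {G : Type*} [Ring G] [Module Gᵐᵒᵖ U] [SMulCommClass L Gᵐᵒᵖ U] [SMulCommClass Gᵐᵒᵖ L U] :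
    Module G (HomFrom L U E) where
  smul g f := LinearMap.comp (f : U →ₗ[L] E) (Module.toModuleEnd L U (op g))
  one_smul := fun (f : U →ₗ[L] E) => LinearMap.ext fun x => congrArg f (one_smul Gᵐᵒᵖ x)
  mul_smul a b := fun (f : U →ₗ[L] E) =>
    LinearMap.ext fun x => congrArg f (mul_smul (op b) (op a) x)
  smul_zero _ := LinearMap.ext fun _ => rfl
  smul_add _ _ _ := LinearMap.ext fun _ => rfl
  add_smul a b := fun (f : U →ₗ[L] E) => LinearMap.ext fun x =>
    (congrArg f (add_smul (op a) (op b) x)).trans (map_add f _ _)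
  zero_smul := fun (f : U →ₗ[L] E) => LinearMap.ext fun x =>
    (congrArg f (zero_smul Gᵐᵒᵖ x)).trans (map_zero f)

end HomModule

section Flat

variable (G : Type u) [Ring G]

/-- The subgroup of `N ⊗_ℤ M` generated by the elements `n g ⊗ m - n ⊗ g m`. -/
def balancedRel (N : Type v) [AddCommGroup N] [Module Gᵐᵒᵖ N]
    (M : Type w) [AddCommGroup M] [Module G M] : AddSubgroup (N ⊗[ℤ] M) :=
  AddSubgroup.closure {t | ∃ (n : N) (g : G) (m : M), t = (op g • n) ⊗ₜ[ℤ] m - n ⊗ₜ[ℤ] (g • m)}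

/-- The tensor product `N ⊗_G M` of a right module and a left module over a ring `G` that need not
be commutative. -/
abbrev BalancedTensor (N : Type v) [AddCommGroup N] [Module Gᵐᵒᵖ N]
    (M : Type w) [AddCommGroup M] [Module G M] : Type (max v w) :=
  (N ⊗[ℤ] M) ⧸ balancedRel G N M

/-- The homomorphism `f ⊗_G M : N ⊗_G M → N' ⊗_G M`. -/
def BalancedTensor.map {N N' : Type v} [AddCommGroup N] [Module Gᵐᵒᵖ N]
    [AddCommGroup N'] [Module Gᵐᵒᵖ N'] (f : N →ₗ[Gᵐᵒᵖ] N')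
    (M : Type w) [AddCommGroup M] [Module G M] :
    BalancedTensor G N M →+ BalancedTensor G N' M :=
  QuotientAddGroup.map (balancedRel G N M) (balancedRel G N' M)
    (LinearMap.rTensor M f.toAddMonoidHom.toIntLinearMap).toAddMonoidHom (by
      refine (AddSubgroup.closure_le _).2 ?_
      rintro _ ⟨n, g, m, rfl⟩
      refine AddSubgroup.subset_closure ⟨f n, g, m, ?_⟩
      rw [map_sub]
      exact congrArg (fun x => x ⊗ₜ[ℤ] m - f n ⊗ₜ[ℤ] (g • m)) (f.map_smul (op g) n))

/-- A left `G`-module `M` is flat if `- ⊗_G M` preserves injectivity of homomorphisms of right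
`G`-modules. -/
def IsLeftFlat (M : Type w) [AddCommGroup M] [Module G M] : Prop :=
  ∀ (N N' : Type u) [AddCommGroup N] [Module Gᵐᵒᵖ N] [AddCommGroup N'] [Module Gᵐᵒᵖ N']
    (f : N →ₗ[Gᵐᵒᵖ] N'), Function.Injective f → Function.Injective (BalancedTensor.map G f M)

end Flat

/-- An injective resolution `0 → Z → I⁰ → I¹ → ⋯` is minimal if for every `n` the kernel of
`Iⁿ → Iⁿ⁺¹` (which is the image of the preceding map) is an essential submodule of `Iⁿ`, that is,
if `Iⁿ` is an injective envelope of this kernel. -/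
def IsMinimalInjectiveResolution {L : Type u} [Ring L] {Z : ModuleCat.{u} L}
    (I : InjectiveResolution Z) : Prop :=
  ∀ (n : ℕ) (W : Submodule L (I.cocomplex.X n)),
    W ⊓ LinearMap.ker (I.cocomplex.d n (n + 1)).hom = ⊥ → W = ⊥

/-! `U ⊗_Γ -` and `Hom_Λ(U, -)` match `add U` with the finitely generated projective `Γ`-modules. If
`E` is in `add U`, then `Hom_Λ(U, E)` is a summand of `Hom_Λ(U, U)^n = Γ^n`, hence flat. Conversely,
minimality makes `E_k` finitely generated (`Module.Finite.of_essential`), so a flat `Hom_Λ(U, E_k)`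
is finitely generated over a noetherian ring and thus projective (`IsLeftFlat.projective`). For
injective `E` the evaluation `U ⊗_Γ Hom_Λ(U, E) → E` is bijective (`tensorEval_bijective`), which
makes `E_k` a summand of `U ⊗_Γ Γ^n = U^n`.

For injectivity of `U`, suppose `k ≥ 1`. The resolution stops at `E_k`, so `Ext^k(U, U) = 0` says
that every map `U → E_k` lifts to `E_{k-1}`. If `E_k` is in `add U`, its identity lifts too, and the
differential has a section. The image of this section meets the kernel trivially, so minimality
forces `E_k = 0`, contradicting injective dimension `k`. For `U = Λ`, flatness puts `E_k` in `add Λ`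
directly. -/

/-! ### Universal property of the balanced tensor product. -/

namespace BalancedTensor

variable (G : Type u) [Ring G] {N N' : Type v} [AddCommGroup N] [Module Gᵐᵒᵖ N]
  [AddCommGroup N'] [Module Gᵐᵒᵖ N'] {M : Type w} [AddCommGroup M] [Module G M]
  {A : Type*} [AddCommGroup A]

variable (N M) in
/-- The universal biadditive map `N × M → N ⊗_G M`. -/
def tmul : N →+ M →+ BalancedTensor G N M :=
  AddMonoidHom.mk' (fun x => AddMonoidHom.mk' (fun m => QuotientAddGroup.mk (x ⊗ₜ[ℤ] m))
    fun a b => by rw [TensorProduct.tmul_add]; rfl)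
    fun a b => by ext m; exact congrArg QuotientAddGroup.mk (TensorProduct.add_tmul a b m)

theorem smul_tmul (x : N) (g : G) (m : M) :
    tmul G N M (op g • x) m = tmul G N M x (g • m) := by
  refine (QuotientAddGroup.eq_iff_sub_mem).2 ?_
  exact AddSubgroup.subset_closure ⟨x, g, m, rfl⟩

theorem map_tmul (f : N →ₗ[Gᵐᵒᵖ] N') (x : N) (m : M) :
    BalancedTensor.map G f M (tmul G N M x m) = tmul G N' M (f x) m :=
  rfl

theorem addHom_ext {α β : BalancedTensor G N M →+ A}
    (h : ∀ x m, α (tmul G N M x m) = β (tmul G N M x m)) : α = β := by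
  refine QuotientAddGroup.addMonoidHom_ext _ (AddMonoidHom.ext fun t => ?_)
  induction t with
  | zero => rw [map_zero, map_zero]
  | tmul x m => exact h x m
  | add a b ha hb => rw [map_add, map_add, ha, hb]

/-- The homomorphism on `N ⊗_G M` induced by a balanced biadditive map. -/
def lift (β : N →+ M →+ A) (h : ∀ x (g : G) m, β (op g • x) m = β x (g • m)) :
    BalancedTensor G N M →+ A :=
  QuotientAddGroup.lift (balancedRel G N M)
    (TensorProduct.liftAddHom β fun r x m => by simp) (by
      refine (AddSubgroup.closure_le _).2 ?_
      rintro _ ⟨n, g, m, rfl⟩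
      change TensorProduct.liftAddHom β _ _ = 0
      rw [map_sub, TensorProduct.liftAddHom_tmul, TensorProduct.liftAddHom_tmul, h, sub_self])

theorem lift_tmul (β : N →+ M →+ A) (h : ∀ x (g : G) m, β (op g • x) m = β x (g • m))
    (x : N) (m : M) : lift G β h (tmul G N M x m) = β x m :=
  TensorProduct.liftAddHom_tmul (R := ℤ) β (fun r x m => by simp) x m

end BalancedTensor

open BalancedTensor

/-! ### Flat and projective modules. -/

theorem LinearMap.sum_smul_apply_single {G : Type u} [Ring G] {M : Type w} [AddCommGroup M]
    [Module G M] {n : ℕ} (p : (Fin n → G) →ₗ[G] M) (w : Fin n → G) :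
    ∑ i, w i • p (Pi.single i 1) = p w := by
  simp_rw [← map_smul, ← Pi.single_smul, smul_eq_mul, mul_one]
  rw [← map_sum, Finset.univ_sum_single]

/-- Finitely generated projective modules are flat. -/
theorem IsLeftFlat.of_finite_projective (G : Type u) [Ring G] (M : Type w) [AddCommGroup M]
    [Module G M] [Module.Finite G M] [Module.Projective G M] : IsLeftFlat G M := by
  intro N N' _ _ _ _ f hf
  obtain ⟨n, p, a, -, -, hpa⟩ := Module.Finite.exists_comp_eq_id_of_projective G M
  have hpa' (m : M) : ∑ i, a m i • p (Pi.single i 1) = m := by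
    rw [p.sum_smul_apply_single]
    exact LinearMap.congr_fun hpa m
  -- `T X` is `X ⊗ a : X ⊗ M → X ⊗ G^n = X^n`. It is split by `X ⊗ p` and natural in `X`, so
  -- injectivity passes from `f^n` to `f ⊗ M`.
  let T (X : Type u) [AddCommGroup X] [Module Gᵐᵒᵖ X] : BalancedTensor G X M →+ (Fin n → X) :=
    lift G (AddMonoidHom.mk' (fun x => AddMonoidHom.mk' (fun m i => op (a m i) • x)
      fun m m' => by ext i; simp [add_smul]) fun x x' => by ext m i; simp)
      fun x g m => by ext i; simp [mul_smul]
  have hT (X : Type u) [AddCommGroup X] [Module Gᵐᵒᵖ X] (x : X) (m : M) :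
      T X (tmul G X M x m) = fun i => op (a m i) • x := lift_tmul G _ _ x m
  have hinj : Function.Injective (T N) := by
    let S : (Fin n → N) →+ BalancedTensor G N M :=
      ∑ i, ((tmul G N M).flip (p (Pi.single i 1))).comp (Pi.evalAddMonoidHom _ i)
    have : S.comp (T N) = AddMonoidHom.id _ := addHom_ext G fun x m => by
      simp only [AddMonoidHom.comp_apply, hT, S, AddMonoidHom.finsetSum_apply,
        Pi.evalAddMonoidHom_apply, AddMonoidHom.flip_apply, smul_tmul, AddMonoidHom.id_apply]
      rw [← map_sum, hpa']
    exact Function.LeftInverse.injective (g := S) fun t => DFunLike.congr_fun this t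
  have hnat : (T N').comp (BalancedTensor.map G f M) =
      (f.toAddMonoidHom.compLeft (Fin n)).comp (T N) := addHom_ext G fun x m => by
    simp only [AddMonoidHom.comp_apply, map_tmul, hT]
    ext i
    simp
  refine Function.Injective.of_comp (f := T N') ?_
  have h2 : T N' ∘ BalancedTensor.map G f M = (fun y i => f (y i)) ∘ T N :=
    funext fun t => DFunLike.congr_fun hnat t
  rw [h2]
  exact Function.Injective.comp (fun y y' h => funext fun i => hf (congrFun h i)) hinj

/-- The equational criterion: if finitely many relations `∑ i, r l i • m i = 0` hold in a flat
module, then they follow from relations in the ring. -/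
theorem IsLeftFlat.mem_closure_of_relations {G : Type u} [Ring G] {M : Type w} [AddCommGroup M]
    [Module G M] (hM : IsLeftFlat G M) {n k : ℕ} (r : Fin k → Fin n → G) (m : Fin n → M)
    (hr : ∀ l, ∑ i, r l i • m i = 0) :
    m ∈ AddSubgroup.closure {x : Fin n → M |
      ∃ (ν : Fin n → G) (μ : M), (∀ l, ∑ i, r l i * ν i = 0) ∧ x = fun i => ν i • μ} := by
  set Q := AddSubgroup.closure {x : Fin n → M |
      ∃ (ν : Fin n → G) (μ : M), (∀ l, ∑ i, r l i * ν i = 0) ∧ x = fun i => ν i • μ}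
  let φ : (Fin n → G) →ₗ[Gᵐᵒᵖ] (Fin k → G) :=
    { toFun := fun x l => ∑ i, r l i * x i
      map_add' := fun x y => by ext l; simp [mul_add, Finset.sum_add_distrib]
      map_smul' := fun g x => by ext l; simp [Finset.sum_mul, mul_assoc] }
  let I := LinearMap.range φ
  -- Two preimages under `φ` differ by a solution of the ring relations, so `φ x ⊗ μ ↦ (x i • μ)_i`
  -- is well defined modulo `Q`.
  have key (x x' : Fin n → G) (μ : M) (h : φ x = φ x') :
      (QuotientAddGroup.mk (fun i => x i • μ) : (Fin n → M) ⧸ Q) =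
        QuotientAddGroup.mk (fun i => x' i • μ) := by
    refine QuotientAddGroup.eq_iff_sub_mem.2 (AddSubgroup.subset_closure ⟨x - x', μ, ?_, ?_⟩)
    · intro l
      have := congrFun (sub_eq_zero.2 h) l
      rw [← map_sub] at this
      exact this
    · ext i
      simp [sub_smul]
  choose c hc using fun y : I => y.2
  let β : I →+ M →+ (Fin n → M) ⧸ Q :=
    AddMonoidHom.mk' (fun y => AddMonoidHom.mk'
      (fun μ => QuotientAddGroup.mk fun i => c y i • μ) fun μ μ' => by
        rw [← QuotientAddGroup.mk_add]
        congr 1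
        ext i
        simp) fun y y' => by
        ext μ
        change (QuotientAddGroup.mk _ : (Fin n → M) ⧸ Q) =
          QuotientAddGroup.mk _ + QuotientAddGroup.mk _
        rw [key (c (y + y')) (c y + c y') μ (by rw [map_add, hc, hc, hc]; rfl),
          ← QuotientAddGroup.mk_add]
        congr 1
        ext i
        simp [add_smul]
  have hβ (y : I) (g : G) (μ : M) : β (op g • y) μ = β y (g • μ) := by
    change (QuotientAddGroup.mk _ : (Fin n → M) ⧸ Q) = QuotientAddGroup.mk _
    rw [key (c (op g • y)) (op g • c y) μ (by rw [map_smul, hc, hc]; rfl)]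
    congr 1
    ext i
    simp [mul_smul]
  -- In `G^k ⊗ M` this element becomes `∑ l, e_l ⊗ ∑ i, r l i • m i = 0`. Flatness kills it already
  -- in `I ⊗ M`, while `lift G β hβ` sends it to the class of `m`.
  let t : BalancedTensor G I M :=
    ∑ i, tmul G I M ⟨φ (Pi.single i 1), LinearMap.mem_range_self _ _⟩ (m i)
  have hφ (i : Fin n) : φ (Pi.single i 1) = ∑ l, op (r l i) • (Pi.single l 1 : Fin k → G) := by
    ext l
    simp [φ, Finset.sum_apply, Pi.single_apply]
  have ht : t = 0 := by
    refine hM I (Fin k → G) I.subtype I.injective_subtype ?_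
    rw [map_zero]
    simp only [t, map_sum, map_tmul, Submodule.subtype_apply, hφ, AddMonoidHom.finsetSum_apply,
      smul_tmul]
    rw [Finset.sum_comm]
    refine Finset.sum_eq_zero fun l _ => ?_
    rw [← map_sum, hr, map_zero]
  have h0 := congrArg (lift G β hβ) ht
  simp only [t, map_sum, lift_tmul, map_zero] at h0
  have h1 (i : Fin n) : β ⟨φ (Pi.single i 1), LinearMap.mem_range_self _ _⟩ (m i) =
      QuotientAddGroup.mk' Q (Pi.single i (m i)) := by
    change (QuotientAddGroup.mk _ : (Fin n → M) ⧸ Q) = QuotientAddGroup.mk _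
    rw [key _ (Pi.single i 1) (m i) (hc _)]
    congr 1
    ext j
    by_cases h : j = i
    · subst h; simp
    · simp [h]
  simp only [h1] at h0
  rw [← map_sum, Finset.univ_sum_single] at h0
  exact (QuotientAddGroup.eq_zero_iff m).1 h0

/-- Finitely generated flat left modules over a left noetherian ring are projective. -/
theorem IsLeftFlat.projective {G : Type u} [Ring G] [IsNoetherianRing G] {M : Type w}
    [AddCommGroup M] [Module G M] [Module.Finite G M] (hM : IsLeftFlat G M) :
    Module.Projective G M := by
  obtain ⟨n, p, hp⟩ := Module.Finite.exists_fin' G M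
  obtain ⟨k, r, hr⟩ := Submodule.fg_iff_exists_fin_generating_family.1
    (IsNoetherian.noetherian (LinearMap.ker p))
  have hrel := hM.mem_closure_of_relations r (fun i => p (Pi.single i 1)) fun l => by
    rw [p.sum_smul_apply_single, ← LinearMap.mem_ker, ← hr]
    exact Submodule.subset_span ⟨l, rfl⟩
  -- A generator `(ν, μ)` of the closure yields `w ↦ (∑ i, w i * ν i) • z` with `z` a lift of `μ`,
  -- and these maps add up. The resulting `σ` kills `ker p` and satisfies `p ∘ σ = p`, so it
  -- descends to a section of `p`.
  obtain ⟨σ, hσ, hσp⟩ : ∃ σ : (Fin n → G) →ₗ[G] (Fin n → G), (∀ l, σ (r l) = 0) ∧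
      ∀ i, p (σ (Pi.single i 1)) = p (Pi.single i 1) := by
    refine AddSubgroup.closure_induction (p := fun x _ => ∃ σ : (Fin n → G) →ₗ[G] (Fin n → G),
      (∀ l, σ (r l) = 0) ∧ ∀ i, p (σ (Pi.single i 1)) = x i) ?_ ?_ ?_ ?_ hrel
    · rintro _ ⟨ν, μ, hν, rfl⟩
      obtain ⟨z, rfl⟩ := hp μ
      refine ⟨(Fintype.linearCombination G ν).smulRight z, fun l => ?_, fun i => ?_⟩
      · simp [Fintype.linearCombination_apply, hν l]
      · simp [Fintype.linearCombination_apply_single]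
    · exact ⟨0, fun _ => rfl, fun _ => by simp⟩
    · rintro x y - - ⟨σ, h, h'⟩ ⟨τ, k, k'⟩
      exact ⟨σ + τ, fun l => by simp [h, k], fun i => by simp [h', k']⟩
    · rintro x - ⟨σ, h, h'⟩
      exact ⟨-σ, fun l => by simp [h], fun i => by simp [h']⟩
  have hker : LinearMap.ker p ≤ LinearMap.ker σ := by
    rw [← hr, Submodule.span_le]
    rintro _ ⟨l, rfl⟩
    exact hσ l
  have hpσ : p ∘ₗ σ = p := by
    refine LinearMap.pi_ext' fun i => LinearMap.ext_ring ?_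
    exact hσp i
  let e := p.quotKerEquivOfSurjective hp
  refine Module.Projective.of_split ((LinearMap.ker p).liftQ σ hker ∘ₗ e.symm.toLinearMap) p ?_
  ext x
  obtain ⟨w, rfl⟩ := hp x
  have : e.symm (p w) = (LinearMap.ker p).mkQ w := by
    rw [LinearEquiv.symm_apply_eq]; rfl
  simp only [LinearMap.comp_apply, LinearEquiv.coe_coe, this, LinearMap.id_apply]
  exact LinearMap.congr_fun hpσ w

/-! ### Finiteness over artin algebras. -/

/-- If `K` is an essential submodule of `E` that is noetherian over `R`, then `Hom_L(M, E)` is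
noetherian over `R` for every module `M` of finite length. -/
theorem IsFiniteLength.isNoetherian_linearMap (R : Type v) [CommRing R] {L : Type u} [Ring L] [Algebra R L]
    {E : Type w} [AddCommGroup E] [Module L E]
    [Module R E] [IsScalarTower R L E] {K : Submodule L E}
    (hK : ∀ W : Submodule L E, W ⊓ K = ⊥ → W = ⊥) [IsNoetherian R K]
    {M : Type*} [AddCommGroup M] [Module L M] (hM : IsFiniteLength L M) :
    IsNoetherian R (M →ₗ[L] E) := by
  induction hM with
  | of_subsingleton => infer_instance
  | @of_simple_quotient M _ _ N _ _ ih =>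
    have hsimple : IsNoetherian R (M ⧸ N →ₗ[L] E) := by
      have := IsSimpleModule.nontrivial L (M ⧸ N)
      obtain ⟨s, hs⟩ := exists_ne (0 : M ⧸ N)
      -- By simplicity, the image of `φ` either lies in `K` or meets it trivially; in the second
      -- case it is zero by essentiality.
      have hmem (φ : M ⧸ N →ₗ[L] E) : φ s ∈ K := by
        rcases eq_bot_or_eq_top (K.comap φ) with h | h
        · have h0 : LinearMap.range φ = ⊥ := hK _ <| by
            rw [eq_bot_iff]
            rintro _ ⟨⟨x, rfl⟩, hx⟩
            have : x ∈ K.comap φ := hx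
            rw [h, Submodule.mem_bot] at this
            simp [this]
          rw [LinearMap.range_eq_bot.1 h0]
          exact K.zero_mem
        · have : s ∈ K.comap φ := h ▸ Submodule.mem_top
          exact this
      let ev : (M ⧸ N →ₗ[L] E) →ₗ[R] K :=
        { toFun := fun φ => ⟨φ s, hmem φ⟩
          map_add' := fun _ _ => rfl
          map_smul' := fun _ _ => rfl }
      refine isNoetherian_of_injective ev fun φ ψ h => ?_
      refine LinearMap.ext_on (s := {s}) (IsSimpleModule.span_singleton_eq_top L hs) ?_
      rintro _ rfl
      exact congrArg Subtype.val h
    let f : (M ⧸ N →ₗ[L] E) →ₗ[R] (M →ₗ[L] E) :=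
      { toFun := fun φ => φ ∘ₗ N.mkQ
        map_add' := fun _ _ => rfl
        map_smul' := fun _ _ => rfl }
    let g : (M →ₗ[L] E) →ₗ[R] (N →ₗ[L] E) :=
      { toFun := fun φ => φ ∘ₗ N.subtype
        map_add' := fun _ _ => rfl
        map_smul' := fun _ _ => rfl }
    refine isNoetherian_of_range_eq_ker f g (le_antisymm ?_ fun φ hφ => ?_)
    · rintro _ ⟨φ, rfl⟩
      refine LinearMap.ext fun x => ?_
      change φ (N.mkQ x) = 0
      rw [Submodule.mkQ_apply, (Submodule.Quotient.mk_eq_zero N).2 x.2, map_zero]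
    · refine ⟨N.liftQ φ fun x hx => ?_, N.liftQ_mkQ φ _⟩
      exact LinearMap.congr_fun (LinearMap.mem_ker.1 hφ) ⟨x, hx⟩

/-- An essential extension of a finitely generated module over an artin algebra is finitely
generated. -/
theorem Module.Finite.of_essential (R : Type v) [CommRing R] [IsArtinianRing R] {L : Type u}
    [Ring L] [Algebra R L] [Module.Finite R L]
    {E : Type w} [AddCommGroup E] [Module L E]
    (K : Submodule L E) (hK : ∀ W : Submodule L E, W ⊓ K = ⊥ → W = ⊥) [Module.Finite L K] :
    Module.Finite L E := by
  let : Module R E := Module.compHom E (algebraMap R L)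
  have : IsScalarTower R L E := ⟨fun r l x => by
    rw [Algebra.smul_def, mul_smul]; rfl⟩
  have : Module.Finite R K := Module.Finite.trans L K
  have : IsNoetherian R K := inferInstance
  have : IsArtinian R L := inferInstance
  have : IsNoetherian R L := inferInstance
  have : IsNoetherian L L := isNoetherian_of_tower R inferInstance
  have : IsArtinian L L := isArtinian_of_tower R inferInstance
  -- Taking `M = L` suffices, because `Hom_L(L, E)` maps onto `E` by evaluation at `1`.
  have := (isFiniteLength_iff_isNoetherian_isArtinian.2
    ⟨‹IsNoetherian L L›, ‹_›⟩).isNoetherian_linearMap R hK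
  let ev : (L →ₗ[L] E) →ₗ[R] E :=
    { toFun := fun φ => φ 1
      map_add' := fun _ _ => rfl
      map_smul' := fun _ _ => rfl }
  have : Module.Finite R E := Module.Finite.of_surjective ev fun x =>
    ⟨LinearMap.toSpanSingleton L E x, by simp [ev]⟩
  exact Module.Finite.of_restrictScalars_finite R L E

theorem CategoryTheory.InjectiveResolution.ker_d_succ {L : Type u} [Ring L] {Z : ModuleCat.{u} L}
    (I : InjectiveResolution Z) (n : ℕ) :
    LinearMap.ker (I.cocomplex.d (n + 1) (n + 2)).hom =
      LinearMap.range (I.cocomplex.d n (n + 1)).hom := by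
  have := (ShortComplex.moduleCat_exact_iff_range_eq_ker _).1 (I.exact_succ n)
  exact this.symm

/-- The terms of a minimal injective resolution of a finitely generated module over an artin
algebra are finitely generated. -/
theorem IsMinimalInjectiveResolution.finite (R : Type v) [CommRing R] [IsArtinianRing R] {L : Type u}
    [Ring L] [Algebra R L] [Module.Finite R L]
    {Z : ModuleCat.{u} L} [Module.Finite L Z]
    {I : InjectiveResolution Z} (hI : IsMinimalInjectiveResolution I) (n : ℕ) :
    Module.Finite L (I.cocomplex.X n) := by
  induction n with
  | zero =>
    have : Module.Finite L (LinearMap.ker (I.cocomplex.d 0 1).hom) := by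
      have h := (ShortComplex.moduleCat_exact_iff_range_eq_ker _).1 I.exact₀
      have h' : LinearMap.range (I.ι.f 0).hom = LinearMap.ker (I.cocomplex.d 0 1).hom := h
      rw [← h']
      have : Module.Finite L (((CochainComplex.single₀ (ModuleCat L)).obj Z).X 0) :=
        ‹Module.Finite L Z›
      infer_instance
    exact Module.Finite.of_essential R _ (hI 0)
  | succ n ih =>
    have : Module.Finite L (LinearMap.ker (I.cocomplex.d (n + 1) (n + 1 + 1)).hom) := by
      rw [I.ker_d_succ n]
      infer_instance
    exact Module.Finite.of_essential R _ (hI (n + 1))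

/-- If `G` acts through all `L`-endomorphisms of `U`, then `Hom_L(U, E)` is finitely generated
over `G` for finitely generated `U` and `E`. -/
theorem HomFrom.finite (R : Type v) [CommRing R] [IsArtinianRing R] {L : Type u} [Ring L]
    [Algebra R L] [Module.Finite R L] {G : Type u} [Ring G] {U : Type u} [AddCommGroup U]
    [Module L U] [Module Gᵐᵒᵖ U] [SMulCommClass L Gᵐᵒᵖ U] [SMulCommClass Gᵐᵒᵖ L U]
    [Module.Finite L U] (hG : Function.Surjective
      (Module.toModuleEnd L U : Gᵐᵒᵖ →+* Module.End L U))
    (E : Type w) [AddCommGroup E] [Module L E] [Module.Finite L E] :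
    Module.Finite G (HomFrom L U E) := by
  let : Module R E := Module.compHom E (algebraMap R L)
  have : IsScalarTower R L E := ⟨fun r l x => by
    rw [Algebra.smul_def, mul_smul]; rfl⟩
  have : Module.Finite R E := Module.Finite.trans L E
  obtain ⟨t, p, hp⟩ := Module.Finite.exists_fin' L U
  let ev : (U →ₗ[L] E) →ₗ[R] (Fin t → E) :=
    { toFun := fun φ i => φ (p (Pi.single i 1))
      map_add' := fun _ _ => rfl
      map_smul' := fun _ _ => rfl }
  have : IsNoetherian R (U →ₗ[L] E) := isNoetherian_of_injective ev fun φ ψ h => by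
    have : φ ∘ₗ p = ψ ∘ₗ p := LinearMap.pi_ext' fun i => LinearMap.ext_ring (congrFun h i)
    ext x
    obtain ⟨y, rfl⟩ := hp x
    exact LinearMap.congr_fun this y
  obtain ⟨s, hs⟩ := (Module.Finite.fg_top : (⊤ : Submodule R (U →ₗ[L] E)).FG)
  -- Multiplication by a central scalar is an `L`-endomorphism of `U`, hence given by some `g`.
  -- Generators over `R` therefore generate over `G`.
  have hsmul (r : R) (φ : U →ₗ[L] E) : ∃ g : G, (r • φ : U →ₗ[L] E) =
      (show U →ₗ[L] E from g • (show HomFrom L U E from φ)) := by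
    obtain ⟨g, hg⟩ := hG
      { toFun := fun x => algebraMap R L r • x
        map_add' := fun x y => smul_add _ x y
        map_smul' := fun l x => by
          simp only [RingHom.id_apply, ← mul_smul, Algebra.commutes] }
    refine ⟨g.unop, LinearMap.ext fun x => ?_⟩
    have h := LinearMap.congr_fun hg x
    change r • φ x = φ (Module.toModuleEnd L U g x)
    rw [h]
    exact (φ.map_smul _ _).symm
  refine ⟨⟨s, ?_⟩⟩
  rw [eq_top_iff]
  rintro (φ : U →ₗ[L] E) -
  have hφ : φ ∈ Submodule.span R (s : Set (U →ₗ[L] E)) := hs ▸ Submodule.mem_top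
  induction hφ using Submodule.span_induction with
  | mem x hx => exact Submodule.subset_span hx
  | zero => exact Submodule.zero_mem _
  | add x y _ _ hx hy => exact Submodule.add_mem _ hx hy
  | smul r x _ hx =>
    obtain ⟨g, hg⟩ := hsmul r x
    rw [hg]
    exact Submodule.smul_mem _ g hx

/-! ### The class `add U` and the evaluation map. -/

theorem isInAdd_iff_exists_retract {L : Type u} [Ring L] {U : Type v} [AddCommGroup U]
    [Module L U] {M : Type w} [AddCommGroup M] [Module L M] :
    IsInAdd L U M ↔ ∃ (n : ℕ) (i : M →ₗ[L] (Fin n → U)) (p : (Fin n → U) →ₗ[L] M),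
      p ∘ₗ i = LinearMap.id := by
  constructor
  · rintro ⟨n, P, Q, h, ⟨e⟩⟩
    refine ⟨n, P.subtype ∘ₗ e.toLinearMap, e.symm.toLinearMap ∘ₗ P.projectionOnto Q h, ?_⟩
    ext x
    simp
  · rintro ⟨n, i, p, h⟩
    have hi : Function.LeftInverse p i := fun x => LinearMap.congr_fun h x
    refine ⟨n, LinearMap.range i, LinearMap.ker p, ?_, ⟨LinearEquiv.ofInjective i hi.injective⟩⟩
    exact LinearMap.isCompl_of_proj (f := i.rangeRestrict ∘ₗ p) (by
      rintro ⟨_, x, rfl⟩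
      ext1
      simp [hi x]) |> fun hc => by
        rwa [LinearMap.ker_comp_of_ker_eq_bot] at hc
        rw [LinearMap.ker_rangeRestrict, LinearMap.ker_eq_bot]
        exact hi.injective

section Evaluation

variable {L : Type u} [Ring L] {G : Type u} [Ring G] {U : Type u} [AddCommGroup U] [Module L U]
  [Module Gᵐᵒᵖ U] [SMulCommClass L Gᵐᵒᵖ U] [SMulCommClass Gᵐᵒᵖ L U]
  {E : Type u} [AddCommGroup E] [Module L E]

/-- An element of `Hom_L(U, E)` as a linear map. -/
def HomFrom.toLinearMap (φ : HomFrom L U E) : U →ₗ[L] E := φ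

/-- A linear map as an element of `Hom_L(U, E)`. -/
def HomFrom.of (φ : U →ₗ[L] E) : HomFrom L U E := φ

/-- The evaluation pairing `U × Hom_L(U, E) → E`. -/
def HomFrom.eval (L U E : Type u) [Ring L] [AddCommGroup U] [Module L U] [AddCommGroup E]
    [Module L E] : U →+ HomFrom L U E →+ E :=
  AddMonoidHom.mk' (fun x => AddMonoidHom.mk' (fun φ => φ.toLinearMap x) fun _ _ => rfl)
    fun x y => AddMonoidHom.ext fun φ => map_add φ.toLinearMap x y

theorem HomFrom.ext {φ ψ : HomFrom L U E} (h : ∀ x, eval L U E x φ = eval L U E x ψ) : φ = ψ :=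
  LinearMap.ext h

theorem HomFrom.eval_smul (x : U) (g : G) (φ : HomFrom L U E) :
    eval L U E x (g • φ) = eval L U E (op g • x) φ :=
  rfl

theorem HomFrom.eval_smul_left (l : L) (x : U) (φ : HomFrom L U E) :
    eval L U E (l • x) φ = l • eval L U E x φ :=
  map_smul φ.toLinearMap l x

variable (L G U E) in
/-- The evaluation homomorphism `U ⊗_G Hom_L(U, E) → E`. -/
def tensorEval : BalancedTensor G U (HomFrom L U E) →+ E :=
  lift G (HomFrom.eval L U E) fun _ _ _ => rfl

theorem tensorEval_tmul (x : U) (φ : HomFrom L U E) :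
    tensorEval L G U E (tmul G U (HomFrom L U E) x φ) = HomFrom.eval L U E x φ :=
  lift_tmul G _ _ x φ

/-- A linear map out of `U^t` that vanishes on the vectors `(l u_i)_i` factors through the
relations of the `u_i`. -/
theorem exists_factor_through_relations [Module.Injective L E]
    (hL : Function.Surjective (Module.toModuleEnd Gᵐᵒᵖ U : L →+* Module.End Gᵐᵒᵖ U))
    {t k : ℕ} (u : (Fin t → Gᵐᵒᵖ) →ₗ[Gᵐᵒᵖ] U) (hu : Function.Surjective u)
    (b : Fin k → Fin t → Gᵐᵒᵖ) (hb : Submodule.span Gᵐᵒᵖ (Set.range b) = LinearMap.ker u)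
    (φ : Fin t → HomFrom L U E)
    (hφ : ∑ i, HomFrom.eval L U E (u (Pi.single i 1)) (φ i) = 0) :
    ∃ h : Fin k → HomFrom L U E, ∀ i, φ i = ∑ j, (b j i).unop • h j := by
  let B : (Fin t → U) →ₗ[L] (Fin k → U) :=
    { toFun := fun y j => ∑ i, b j i • y i
      map_add' := fun x y => by ext j; simp [Finset.sum_add_distrib]
      map_smul' := fun l y => by ext j; simp [Finset.smul_sum, smul_comm l] }
  let f : (Fin t → U) →ₗ[L] E :=
    ∑ i, (φ i).toLinearMap ∘ₗ LinearMap.proj i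
  have hf (y : Fin t → U) : f y = ∑ i, HomFrom.eval L U E (y i) (φ i) := by
    simp only [f, LinearMap.sum_apply]
    rfl
  -- If `B y = 0`, the `y i` satisfy all relations of the generators `u_i`, so `u_i ↦ y i` defines a
  -- `G`-endomorphism of `U`. It is multiplication by some `l`, whence `f y = l • ∑ i, φ i (u_i) =
  -- 0`.
  have hker : LinearMap.ker B ≤ LinearMap.ker f := by
    intro y hy
    let σ : (Fin t → Gᵐᵒᵖ) →ₗ[Gᵐᵒᵖ] U := Fintype.linearCombination Gᵐᵒᵖ y
    have hσ : LinearMap.ker u ≤ LinearMap.ker σ := by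
      rw [← hb, Submodule.span_le]
      rintro _ ⟨j, rfl⟩
      exact congrFun (LinearMap.mem_ker.1 hy) j
    obtain ⟨l, hl⟩ := hL ((LinearMap.ker u).liftQ σ hσ ∘ₗ
      (u.quotKerEquivOfSurjective hu).symm.toLinearMap)
    have hl' (w : Fin t → Gᵐᵒᵖ) : l • u w = σ w := by
      have h1 := LinearMap.congr_fun hl (u w)
      have h2 : (u.quotKerEquivOfSurjective hu).symm (u w) = (LinearMap.ker u).mkQ w := by
        rw [LinearEquiv.symm_apply_eq]; rfl
      simp only [LinearMap.comp_apply, LinearEquiv.coe_coe, h2] at h1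
      exact h1
    have hy' (i : Fin t) : y i = l • u (Pi.single i 1) := by
      rw [hl']
      simp [σ, Fintype.linearCombination_apply_single]
    rw [LinearMap.mem_ker, hf]
    simp only [hy', HomFrom.eval_smul_left]
    rw [← Finset.smul_sum, hφ, smul_zero]
  -- Thus `f` factors through the range of `B`, and injectivity of `E` extends it to `U^k`; the
  -- components of the extension are the required maps.
  obtain ⟨h, hh⟩ := Module.Injective.out (Submodule.subtype (LinearMap.range B))
    (Submodule.injective_subtype _)
    ((LinearMap.ker B).liftQ f hker ∘ₗ B.quotKerEquivRange.symm.toLinearMap)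
  have hhB (y : Fin t → U) : h (B y) = f y := by
    have h1 := hh ⟨B y, LinearMap.mem_range_self B y⟩
    have h2 : B.quotKerEquivRange.symm ⟨B y, LinearMap.mem_range_self B y⟩ =
        (LinearMap.ker B).mkQ y := by
      rw [LinearEquiv.symm_apply_eq]; rfl
    simp only [LinearMap.comp_apply, LinearEquiv.coe_coe, h2] at h1
    exact h1
  refine ⟨fun j => HomFrom.of (h ∘ₗ LinearMap.single L (fun _ => U) j), fun i => HomFrom.ext fun x => ?_⟩
  have h1 := hhB (Pi.single i x)
  rw [hf, Finset.sum_eq_single i (fun j _ hj => by rw [Pi.single_eq_of_ne hj]; simp)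
    (by simp), Pi.single_eq_same] at h1
  rw [← h1, map_sum]
  have h2 : B (Pi.single i x) = ∑ j, Pi.single j (b j i • x) := by
    rw [Finset.univ_sum_single]
    ext j
    change ∑ i', b j i' • (Pi.single i x : Fin t → U) i' = _
    rw [Finset.sum_eq_single i (fun j _ hj => by rw [Pi.single_eq_of_ne hj]; simp)
      (by simp), Pi.single_eq_same]
  rw [h2, map_sum]
  rfl

/-- If `E` is injective, then `U ⊗_G Hom_L(U, E) → E` is an isomorphism. -/
theorem tensorEval_bijective [IsNoetherianRing Gᵐᵒᵖ] [Module.Finite Gᵐᵒᵖ U]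
    [Module.Injective L E]
    (hL : Function.Bijective (Module.toModuleEnd Gᵐᵒᵖ U : L →+* Module.End Gᵐᵒᵖ U)) :
    Function.Bijective (tensorEval L G U E) := by
  obtain ⟨t, u, hu⟩ := Module.Finite.exists_fin' Gᵐᵒᵖ U
  constructor
  · obtain ⟨k, b, hb⟩ := Submodule.fg_iff_exists_fin_generating_family.1
      (IsNoetherian.noetherian (LinearMap.ker u))
    have hform (z : BalancedTensor G U (HomFrom L U E)) : ∃ φ : Fin t → HomFrom L U E,
        z = ∑ i, tmul G U _ (u (Pi.single i 1)) (φ i) := by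
      obtain ⟨z, rfl⟩ := QuotientAddGroup.mk_surjective z
      induction z with
      | zero => exact ⟨0, by simp⟩
      | tmul x m =>
        obtain ⟨w, rfl⟩ := hu x
        refine ⟨fun i => (w i).unop • m, ?_⟩
        change tmul G U (HomFrom L U E) (u w) m = _
        simp only [← smul_tmul, op_unop]
        rw [← u.sum_smul_apply_single w, map_sum, AddMonoidHom.finsetSum_apply]
      | add a b ha hb =>
        obtain ⟨φ, hφ⟩ := ha
        obtain ⟨ψ, hψ⟩ := hb
        refine ⟨φ + ψ, ?_⟩
        rw [QuotientAddGroup.mk_add, hφ, hψ]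
        simp [Finset.sum_add_distrib]
    rw [injective_iff_map_eq_zero]
    intro z hz
    obtain ⟨φ, rfl⟩ := hform z
    simp only [map_sum, tensorEval_tmul] at hz
    obtain ⟨h, hh⟩ := exists_factor_through_relations hL.2 u hu b hb φ hz
    simp only [hh, map_sum, ← smul_tmul, op_unop]
    rw [Finset.sum_comm]
    refine Finset.sum_eq_zero fun j _ => ?_
    have h0 : ∑ i, b j i • u (Pi.single i 1) = 0 := by
      rw [u.sum_smul_apply_single, ← LinearMap.mem_ker, ← hb]
      exact Submodule.subset_span ⟨j, rfl⟩
    rw [← AddMonoidHom.finsetSum_apply, ← map_sum, h0, map_zero, AddMonoidHom.zero_apply]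
  · intro x
    -- Faithfulness embeds `L` in `U^t` by `l ↦ (l u_i)_i`. Extending `1 ↦ x` along this embedding
    -- writes `x` as `∑ i, h_i (u_i)`.
    let ι : L →ₗ[L] (Fin t → U) := LinearMap.toSpanSingleton L _ fun i => u (Pi.single i 1)
    have hι : Function.Injective ι := by
      rw [← LinearMap.ker_eq_bot, eq_bot_iff]
      intro l hl
      refine hL.1 ?_
      rw [map_zero]
      ext y
      obtain ⟨w, rfl⟩ := hu y
      change l • u w = 0
      rw [← u.sum_smul_apply_single w, Finset.smul_sum]
      refine Finset.sum_eq_zero fun i _ => ?_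
      rw [smul_comm]
      have : l • u (Pi.single i 1) = 0 := congrFun (LinearMap.mem_ker.1 hl) i
      rw [this, smul_zero]
    obtain ⟨h, hh⟩ := Module.Injective.out ι hι (LinearMap.toSpanSingleton L E x)
    refine ⟨∑ i, tmul G U (HomFrom L U E) (u (Pi.single i 1))
      (HomFrom.of (h ∘ₗ LinearMap.single L (fun _ => U) i)), ?_⟩
    simp only [map_sum, tensorEval_tmul]
    have h1 := hh 1
    simp only [LinearMap.toSpanSingleton_apply, one_smul, ι] at h1
    rw [← h1]
    conv_rhs => rw [← Finset.univ_sum_single (fun i => u (Pi.single i 1)), map_sum]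
    rfl

/-- If `E` is injective and `Hom_L(U, E)` is a finitely generated projective `G`-module, then `E`
belongs to `add U`. -/
theorem isInAdd_of_projective_homFrom [IsNoetherianRing Gᵐᵒᵖ] [Module.Finite Gᵐᵒᵖ U]
    [Module.Injective L E]
    (hL : Function.Bijective (Module.toModuleEnd Gᵐᵒᵖ U : L →+* Module.End Gᵐᵒᵖ U))
    [Module.Finite G (HomFrom L U E)] [Module.Projective G (HomFrom L U E)] :
    IsInAdd L U E := by
  obtain ⟨n, π, s, -, -, hπs⟩ := Module.Finite.exists_comp_eq_id_of_projective G (HomFrom L U E)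
  let e := AddEquiv.ofBijective _ (tensorEval_bijective (E := E) hL)
  -- `act` is `U ⊗ s` and `p` below corresponds to `U ⊗ π`. The tensor product is only an additive
  -- group here, so `μ l` supplies the action of `l` needed for linearity of `ψ`.
  let act : BalancedTensor G U (HomFrom L U E) →+ (Fin n → U) :=
    lift G (AddMonoidHom.mk' (fun x => AddMonoidHom.mk' (fun φ i => op (s φ i) • x)
      fun m m' => by ext i; simp [add_smul]) fun x x' => by ext m i; simp)
      fun x g m => by ext i; simp [mul_smul]
  have hact (x : U) (φ : HomFrom L U E) :
      act (tmul G U _ x φ) = fun i => op (s φ i) • x := lift_tmul G _ _ x φ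
  let μ (l : L) := BalancedTensor.map G (Module.toModuleEnd Gᵐᵒᵖ U l) (HomFrom L U E)
  have hμe (l : L) (z) : e (μ l z) = l • e z := by
    have : (tensorEval L G U E).comp (μ l) =
        (DistribSMul.toAddMonoidHom E l).comp (tensorEval L G U E) := addHom_ext G fun x φ => by
      simp only [AddMonoidHom.comp_apply, μ, map_tmul, tensorEval_tmul]
      exact HomFrom.eval_smul_left l x φ
    exact DFunLike.congr_fun this z
  have hμact (l : L) (z) : act (μ l z) = l • act z := by
    have : act.comp (μ l) =
        (DistribSMul.toAddMonoidHom (Fin n → U) l).comp act := addHom_ext G fun x φ => by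
      simp only [AddMonoidHom.comp_apply, μ, map_tmul, hact]
      ext i
      exact (smul_comm l _ x).symm
    exact DFunLike.congr_fun this z
  let ψ : E →ₗ[L] (Fin n → U) :=
    { toFun := fun x => act (e.symm x)
      map_add' := fun x y => by rw [map_add, map_add]
      map_smul' := fun l x => by
        rw [RingHom.id_apply, ← hμact]
        congr 1
        rw [AddEquiv.symm_apply_eq, hμe, AddEquiv.apply_symm_apply] }
  let p : (Fin n → U) →ₗ[L] E :=
    ∑ i, (π (Pi.single i 1)).toLinearMap ∘ₗ LinearMap.proj i
  have hp (y : Fin n → U) : p y = ∑ i, HomFrom.eval L U E (y i) (π (Pi.single i 1)) := by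
    simp only [p, LinearMap.sum_apply]
    rfl
  have hpact : p.toAddMonoidHom.comp act = tensorEval L G U E := addHom_ext G fun x φ => by
    rw [AddMonoidHom.comp_apply, tensorEval_tmul, hact]
    refine (hp _).trans ?_
    simp only [← HomFrom.eval_smul]
    rw [← map_sum, π.sum_smul_apply_single]
    exact congrArg _ (LinearMap.congr_fun hπs φ)
  refine isInAdd_iff_exists_retract.2 ⟨n, ψ, p, LinearMap.ext fun x => ?_⟩
  exact (DFunLike.congr_fun hpact (e.symm x)).trans (e.apply_symm_apply x)

/-- If `E` belongs to `add U`, then `Hom_L(U, E)` is a finitely generated projective `G`-module. -/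
theorem IsInAdd.finite_projective_homFrom
    (hG : Function.Bijective (Module.toModuleEnd L U : Gᵐᵒᵖ →+* Module.End L U))
    (hE : IsInAdd L U E) :
    Module.Finite G (HomFrom L U E) ∧ Module.Projective G (HomFrom L U E) := by
  obtain ⟨n, i, p, hpi⟩ := isInAdd_iff_exists_retract.1 hE
  let θ := RingEquiv.ofBijective _ hG
  have hθ (g : Gᵐᵒᵖ) (x : U) : θ g x = g • x := rfl
  have hθ' (φ : U →ₗ[L] U) (x : U) : θ.symm φ • x = φ x := by
    rw [← hθ, RingEquiv.apply_symm_apply]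
  -- `a` and `q` are `Hom_L(U, i)` and `Hom_L(U, p)`, with `Hom_L(U, U)` identified with `G` through
  -- `θ`.
  let a : HomFrom L U E →ₗ[G] (Fin n → G) :=
    { toFun := fun φ j => (θ.symm (LinearMap.proj j ∘ₗ i ∘ₗ φ.toLinearMap)).unop
      map_add' := fun φ ψ => by
        ext j
        rw [Pi.add_apply, ← MulOpposite.unop_add, ← map_add]
        congr 2
        ext x
        exact congrFun (map_add i _ _) j
      map_smul' := fun g φ => by
        ext j
        rw [RingHom.id_apply, Pi.smul_apply, smul_eq_mul, ← unop_op g, ← MulOpposite.unop_mul, unop_op]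
        congr 1
        rw [RingEquiv.symm_apply_eq, map_mul, RingEquiv.apply_symm_apply]
        rfl }
  let q : (Fin n → G) →ₗ[G] HomFrom L U E :=
    Fintype.linearCombination G fun j =>
      HomFrom.of (p ∘ₗ LinearMap.single L (fun _ => U) j)
  have hqa : q ∘ₗ a = LinearMap.id := by
    refine LinearMap.ext fun φ => HomFrom.ext fun x => ?_
    simp only [LinearMap.comp_apply, q, Fintype.linearCombination_apply, map_sum,
      HomFrom.eval_smul, LinearMap.id_apply]
    have h1 (j : Fin n) : op (a φ j) • x = i (HomFrom.eval L U E x φ) j := hθ' _ x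
    simp only [h1]
    have h2 := LinearMap.congr_fun hpi (HomFrom.eval L U E x φ)
    rw [LinearMap.id_apply, LinearMap.comp_apply,
      ← Finset.univ_sum_single (i (HomFrom.eval L U E x φ)), map_sum] at h2
    exact h2
  refine ⟨Module.Finite.of_surjective q fun φ => ⟨a φ, LinearMap.congr_fun hqa φ⟩, ?_⟩
  exact Module.Projective.of_split a q hqa

end Evaluation

/-! ### Minimal resolutions and injective dimension. -/

section MinimalResolution

variable {L : Type u} [Ring L] {Z : ModuleCat.{u} L} {I : InjectiveResolution Z}

/-- In a minimal injective resolution, a linear map into a term is zero if its composition with the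
differential is injective. -/
theorem IsMinimalInjectiveResolution.eq_zero_of_injective_d_comp
    (hI : IsMinimalInjectiveResolution I) (n : ℕ) {X : Type*} [AddCommGroup X] [Module L X]
    (f : X →ₗ[L] I.cocomplex.X n)
    (hf : Function.Injective ((I.cocomplex.d n (n + 1)).hom ∘ₗ f)) : f = 0 := by
  refine LinearMap.range_eq_bot.1 (hI n _ (eq_bot_iff.2 ?_))
  rintro _ ⟨⟨x, rfl⟩, hx⟩
  have : x = 0 := hf (by rw [map_zero]; exact hx)
  simp [this]

/-- If the injective dimension of `Z` is at most `k`, then a minimal injective resolution of `Z`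
ends at the `k`-th term. -/
theorem IsMinimalInjectiveResolution.d_eq_zero (hI : IsMinimalInjectiveResolution I) (k : ℕ)
    [HasInjectiveDimensionLT Z (k + 1)] : I.cocomplex.d k (k + 1) = 0 := by
  -- The inclusion of `K` represents a class in `Ext^{k+1}(K, Z) = 0`, so it factors as `d ∘ g`.
  -- This composite is injective, so `g = 0` by minimality; hence `K`, which contains the image of
  -- `d`, vanishes.
  let K := LinearMap.ker (I.cocomplex.d (k + 1) (k + 2)).hom
  let j : ModuleCat.of L K ⟶ I.cocomplex.X (k + 1) := ModuleCat.ofHom K.subtype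
  have hj : j ≫ I.cocomplex.d (k + 1) (k + 2) = 0 := by
    ext x
    exact x.2
  obtain ⟨g, hg⟩ := (I.extMk_eq_zero_iff j (k + 2) rfl hj k rfl).1
    (Abelian.Ext.eq_zero_of_hasInjectiveDimensionLT _ (k + 1) le_rfl)
  have hg' : (I.cocomplex.d k (k + 1)).hom ∘ₗ g.hom = K.subtype :=
    congrArg ModuleCat.Hom.hom hg
  have h0 := hI.eq_zero_of_injective_d_comp k g.hom (by
    rw [hg']; exact K.injective_subtype)
  rw [h0, LinearMap.comp_zero] at hg'
  ext x
  have hx : (I.cocomplex.d k (k + 1)).hom x ∈ K := by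
    change _ ∈ LinearMap.ker _
    rw [I.ker_d_succ]
    exact LinearMap.mem_range_self _ _
  exact (LinearMap.congr_fun hg' ⟨_, hx⟩).symm

end MinimalResolution

/-- If all positive self-extensions of `U` vanish, `U` has injective dimension `k`, and the `k`-th
term of a minimal injective resolution of `U` belongs to `add U`, then `U` is injective. -/
theorem IsMinimalInjectiveResolution.injective_of_isInAdd {L : Type u} [Ring L] {U : Type u}
    [AddCommGroup U] [Module L U]
    (hU : ∀ i : ℕ, 1 ≤ i → Subsingleton (Abelian.Ext (ModuleCat.of L U) (ModuleCat.of L U) i))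
    {E : InjectiveResolution (ModuleCat.of L U)} (hE : IsMinimalInjectiveResolution E)
    {k : ℕ} (hk : injectiveDimension (ModuleCat.of L U) = k)
    (hadd : IsInAdd L U (E.cocomplex.X k)) : Module.Injective L U := by
  have hlt : HasInjectiveDimensionLT (ModuleCat.of L U) (k + 1) :=
    (injectiveDimension_le_iff _ k).1 hk.le
  obtain _ | k := k
  · exact (Module.injective_iff_injective_object L U).2
      (injective_iff_hasInjectiveDimensionLT_one.2 hlt)
  exfalso
  have hd := hE.d_eq_zero (k + 1)
  obtain ⟨n, i, p, hpi⟩ := isInAdd_iff_exists_retract.1 hadd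
  -- Since the outgoing differential is zero, every `φ` is a cocycle; its class lies in
  -- `Ext^{k+1}(U, U) = 0`.
  have hlift (φ : U →ₗ[L] E.cocomplex.X (k + 1)) :
      ∃ ψ : U →ₗ[L] E.cocomplex.X k, (E.cocomplex.d k (k + 1)).hom ∘ₗ ψ = φ := by
    obtain ⟨g, hg⟩ := (E.extMk_eq_zero_iff (ModuleCat.ofHom φ) (k + 2) rfl
      (by rw [hd, Limits.comp_zero]) k rfl).1
      (have := hU (k + 1) (by omega); Subsingleton.elim _ _)
    exact ⟨g.hom, congrArg ModuleCat.Hom.hom hg⟩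
  choose ψ hψ using fun j => hlift (p ∘ₗ LinearMap.single L (fun _ => U) j)
  let σ : E.cocomplex.X (k + 1) →ₗ[L] E.cocomplex.X k :=
    (∑ j, ψ j ∘ₗ LinearMap.proj j) ∘ₗ i
  have hσ : (E.cocomplex.d k (k + 1)).hom ∘ₗ σ = LinearMap.id := by
    rw [← hpi, ← LinearMap.comp_assoc]
    congr 1
    refine LinearMap.ext fun y => ?_
    simp only [LinearMap.comp_apply, LinearMap.sum_apply, map_sum]
    conv_rhs => rw [← Finset.univ_sum_single y, map_sum]
    exact Finset.sum_congr rfl fun j _ => LinearMap.congr_fun (hψ j) (y j)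
  have hσ0 := hE.eq_zero_of_injective_d_comp k σ (by rw [hσ]; exact fun _ _ h => h)
  rw [hσ0, LinearMap.comp_zero] at hσ
  -- Now `hσ` says `0 = id` on the term of index `k + 1`. Every class in `Ext^{k+1}(Y, U)` is
  -- represented by a map into that term; higher degrees vanish by `hlt`.
  have hlt' : HasInjectiveDimensionLT (ModuleCat.of L U) (k + 1) := by
    refine HasInjectiveDimensionLT.mk fun m hm Y e => ?_
    obtain rfl | hm := hm.eq_or_lt
    · obtain ⟨f, hf, rfl⟩ := E.extMk_surjective e (k + 2) rfl
      have hf0 : f = 0 := by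
        ext x
        exact (LinearMap.congr_fun hσ (f.hom x)).symm
      subst hf0
      exact E.extMk_zero _ _
    · exact e.eq_zero_of_hasInjectiveDimensionLT (k + 2) hm
  have := injectiveDimension_lt_iff.2 hlt'
  rw [hk] at this
  exact lt_irrefl _ this

/-! ### Flatness criterion and conclusion. -/

theorem IsInAdd.isLeftFlat_homFrom {L G U E : Type u} [Ring L] [Ring G] [AddCommGroup U]
    [Module L U] [Module Gᵐᵒᵖ U] [SMulCommClass L Gᵐᵒᵖ U] [SMulCommClass Gᵐᵒᵖ L U]
    [AddCommGroup E] [Module L E] (hU : IsFaithfullyBalanced L G U) (hE : IsInAdd L U E) :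
    IsLeftFlat G (HomFrom L U E) := by
  obtain ⟨_, _⟩ := hE.finite_projective_homFrom hU.2
  exact .of_finite_projective G _

/-- If `E` is a finitely generated injective module and `Hom_L(U, E)` is flat over `G`, then `E`
belongs to `add U`. -/
theorem isInAdd_of_isLeftFlat_homFrom (R : Type v) [CommRing R] [IsArtinianRing R]
    {L G U E : Type u} [Ring L] [Algebra R L] [Module.Finite R L] [Ring G] [IsNoetherianRing G]
    [IsNoetherianRing Gᵐᵒᵖ] [AddCommGroup U] [Module L U] [Module Gᵐᵒᵖ U]
    [SMulCommClass L Gᵐᵒᵖ U] [SMulCommClass Gᵐᵒᵖ L U] [Module.Finite L U] [Module.Finite Gᵐᵒᵖ U]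
    [AddCommGroup E] [Module L E] [Module.Finite L E] [Module.Injective L E]
    (hU : IsFaithfullyBalanced L G U) (hE : IsLeftFlat G (HomFrom L U E)) : IsInAdd L U E := by
  have := HomFrom.finite R hU.2.2 E
  have := hE.projective
  exact isInAdd_of_projective_homFrom hU.1

/-- Both sides are needed: `G` for the left module `Hom_L(U, E)`, and `Gᵐᵒᵖ` for finitely many
relations of the right module `U`. -/
theorem isNoetherianRing_of_finite_algebra (S : Type v) [CommRing S] [IsArtinianRing S]
    (G : Type u) [Ring G] [Algebra S G] [Module.Finite S G] :
    IsNoetherianRing G ∧ IsNoetherianRing Gᵐᵒᵖ := by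
  have : Module.Finite S Gᵐᵒᵖ := Module.Finite.equiv (MulOpposite.opLinearEquiv S)
  exact ⟨isNoetherian_of_tower S inferInstance, isNoetherian_of_tower S inferInstance⟩

theorem proposition5p1
    {R : Type v} [CommRing R] [IsArtinianRing R]
    {Λ : Type u} [Ring Λ] [Algebra R Λ] [Module.Finite R Λ] :
    (∀ {S : Type w} [CommRing S] [IsArtinianRing S]
      {Γ : Type u} [Ring Γ] [Algebra S Γ] [Module.Finite S Γ]
      {U : Type u} [AddCommGroup U] [Module Λ U] [Module Γᵐᵒᵖ U]
      [SMulCommClass Λ Γᵐᵒᵖ U] [SMulCommClass Γᵐᵒᵖ Λ U]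
      [Module.Finite Λ U] [Module.Finite Γᵐᵒᵖ U],
      IsFaithfullyBalanced Λ Γ U → IsSelforthogonal Λ Γ U →
      ∀ E : InjectiveResolution (ModuleCat.of Λ U), IsMinimalInjectiveResolution E →
      ∀ k : ℕ, injectiveDimension (ModuleCat.of Λ U) = k →
        (IsInAdd Λ U (E.cocomplex.X k) ↔ IsLeftFlat Γ (HomFrom Λ U (E.cocomplex.X k))) ∧
        (IsInAdd Λ U (E.cocomplex.X k) → Module.Injective Λ U)) ∧
    (∀ E : InjectiveResolution (ModuleCat.of Λ Λ), IsMinimalInjectiveResolution E →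
      ∀ k : ℕ, injectiveDimension (ModuleCat.of Λ Λ) = k →
        IsLeftFlat Λ (E.cocomplex.X k) → Module.Injective Λ Λ) := by
  refine ⟨?_, ?_⟩
  · intro S _ _ Γ _ _ _ U _ _ _ _ _ _ _ hbal hself E hE k hk
    obtain ⟨_, _⟩ := isNoetherianRing_of_finite_algebra S Γ
    have hfin : Module.Finite Λ (E.cocomplex.X k) :=
      have : Module.Finite Λ (ModuleCat.of Λ U) := ‹Module.Finite Λ U›
      hE.finite R k
    have hinj : Module.Injective Λ (E.cocomplex.X k) :=
      (Module.injective_iff_injective_object Λ _).2 (E.injective k)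
    exact ⟨⟨fun h => h.isLeftFlat_homFrom hbal, isInAdd_of_isLeftFlat_homFrom R hbal⟩,
      hE.injective_of_isInAdd (fun i hi => (hself i hi).1) hk⟩
  · intro E hE k hk hflat
    obtain ⟨_, _⟩ := isNoetherianRing_of_finite_algebra R Λ
    have hfin : Module.Finite Λ (E.cocomplex.X k) :=
      have : Module.Finite Λ (ModuleCat.of Λ Λ) := inferInstanceAs (Module.Finite Λ Λ)
      hE.finite R k
    -- A finitely generated projective module is a retract of some `Λ^n`, so it is in `add Λ`;
    -- self-extensions vanish because `Λ` is projective.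
    have hproj := hflat.projective
    obtain ⟨n, p, i, -, -, hpi⟩ := Module.Finite.exists_comp_eq_id_of_projective Λ
      (E.cocomplex.X k)
    refine hE.injective_of_isInAdd (fun i hi => ?_) hk
      (isInAdd_iff_exists_retract.2 ⟨n, i, p, hpi⟩)
    obtain ⟨j, rfl⟩ : ∃ j, i = j + 1 := ⟨i - 1, by omega⟩
    have : Projective (ModuleCat.of Λ Λ) := inferInstance
    exact ⟨fun a b => a.eq_zero_of_projective.trans b.eq_zero_of_projective.symm⟩
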